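/- **Definitions.** In a monoid $M$, write $g \preceq h$ if $h = gh'$ for some $h' \in M$ ($g$ is a left-divisor of $h$), and $h \succsim g$ if $h = h'g$ for some $h' \in M$ ($g$ is a right-divisor of $h$). The monoid $M$ is of *$O$-type* if it is left- and right-cancellative, $1$ is its only invertible element, and for all $g,h\in M$ one has ($g \preceq h$ or $h \preceq g$) and ($g \succsim h$ or $h \succsim g$). An element $\delta \in M$ *dominates* $g\in M$ if $g\delta^n \preceq \delta^{n+1}$ and $\delta^{n+1} \succsim \delta^n g$ for every $n \ge 0$. A group $G$ is *left-orderable* if it has a linear ordering $<$ that is left-invariant ($g<g'$ implies $hg<hg'$); the positive cone of $<$ is $\{g\in G : 1<g\}$. The set $\mathrm{LO}(G)$ of all left-invariant linear orderings of $G$, viewed as subsets of $G\times G$, carries the topology induced by the product topology on $\{0,1\}^{G\times G}$ (with $\{0,1\}$ discrete); an ordering is *isolated* if it is an isolated point of $\mathrm{LO}(G)$. **Statement.** Let $p,q,r,s \ge 0$ be integers. 1. If $r \ge p$, then the group $G = \langle x,y \mid x^{p+1} = (y(x^{r-p}y)^s)^{q+1}\rangle$ is left-orderable, and the subsemigroup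 of $G$ generated by $x$ and $yx^{-p}$ is the positive cone of a left-invariant ordering on $G$ that is isolated in $\mathrm{LO}(G)$. 2. Let $M$ be the monoid with generators $a,b,c$ and relations $a = b(a^pb)^q$, $b = c(a^rc)^s$. If $r \ge p$ or $q = 0$, then $a$ dominates $a$, $b$ and $c$ in $M$, and $M$ is of $O$-type. If $r < p$, $q \ge 1$ and $s \ge 1$, then $M$ is not of $O$-type. -/

import Mathlib

namespace OTypeMonoid

/-! ### Monoids of `O`-type

In a (noncommutative) monoid, Mathlib's `g ∣ h` means `∃ h', h = g * h'`, i.e. `g` is a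
left-divisor of `h`. -/

/-- `g` is a right-divisor of `h`. -/
def RightDivides {M : Type*} [Monoid M] (g h : M) : Prop := ∃ h' : M, h = h' * g

/-- A monoid is of right-`O`-type if it is left-cancellative, `1` is its only invertible element,
and any two elements are comparable for left-divisibility. -/
structure IsRightOType (M : Type*) [Monoid M] : Prop where
  cancel : ∀ h g g' : M, h * g = h * g' → g = g'
  eq_one : ∀ g : M, IsUnit g → g = 1
  total : ∀ g h : M, g ∣ h ∨ h ∣ g

/-- A monoid is of left-`O`-type if it is right-cancellative, `1` is its only invertible element,
and any two elements are comparable for right-divisibility. -/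
structure IsLeftOType (M : Type*) [Monoid M] : Prop where
  cancel : ∀ h g g' : M, g * h = g' * h → g = g'
  eq_one : ∀ g : M, IsUnit g → g = 1
  total : ∀ g h : M, RightDivides g h ∨ RightDivides h g

/-- A monoid is of `O`-type if it is both of right- and of left-`O`-type. -/
def IsOType (M : Type*) [Monoid M] : Prop := IsRightOType M ∧ IsLeftOType M

/-- `δ` right-dominates `g` if `g δ ^ n` left-divides `δ ^ (n + 1)` for every `n`. -/
def RightDominates {M : Type*} [Monoid M] (δ g : M) : Prop :=
  ∀ n : ℕ, g * δ ^ n ∣ δ ^ (n + 1)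

/-- `δ` left-dominates `g` if `δ ^ n g` right-divides `δ ^ (n + 1)` for every `n`. -/
def LeftDominates {M : Type*} [Monoid M] (δ g : M) : Prop :=
  ∀ n : ℕ, RightDivides (δ ^ n * g) (δ ^ (n + 1))

/-- `δ` dominates `g` if it does so on both sides. -/
def Dominates {M : Type*} [Monoid M] (δ g : M) : Prop :=
  RightDominates δ g ∧ LeftDominates δ g

/-! ### The space of left-invariant orderings of a group -/

/-- A left-invariant (strict) linear ordering on a group. -/
@[ext]
structure LeftOrdering (G : Type*) [Group G] where
  lt : G → G → Prop
  irrefl : ∀ g, ¬ lt g g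
  trans : ∀ g h k, lt g h → lt h k → lt g k
  trichotomous : ∀ g h, lt g h ∨ g = h ∨ lt h g
  mul_left : ∀ h g g', lt g g' → lt (h * g) (h * g')

/-- A group is (left-)orderable if it has a left-invariant linear ordering. -/
def LeftOrderable (G : Type*) [Group G] : Prop := Nonempty (LeftOrdering G)

/-- The positive cone of a left-invariant ordering. -/
def LeftOrdering.positiveCone {G : Type*} [Group G] (L : LeftOrdering G) : Set G :=
  {g | L.lt 1 g}

open Classical in
/-- The topology of `LO(G)`: a left-invariant ordering is viewed as a subset of `G × G`, i.e. as a
point of the product `{false, true} ^ (G × G)` of discrete two-point spaces, and `LO(G)` carries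
the induced topology. -/
noncomputable instance LeftOrdering.instTopologicalSpace {G : Type*} [Group G] :
    TopologicalSpace (LeftOrdering G) :=
  TopologicalSpace.induced
    (fun (L : LeftOrdering G) (z : G × G) => decide (L.lt z.1 z.2))
    (inferInstance : TopologicalSpace (G × G → Bool))

/-- An ordering is isolated in `LO(G)` if it is an isolated point of that space. -/
def LeftOrdering.Isolated {G : Type*} [Group G] (L : LeftOrdering G) : Prop :=
  IsOpen ({L} : Set (LeftOrdering G))

/-! ### The group `⟨x, y ∣ x ^ (p+1) = (y (x ^ (r-p) y) ^ s) ^ (q+1)⟩` -/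

/-- The two generators of the group. -/
inductive Gen₂
  | x
  | y

open FreeGroup in
/-- The group with generators `x, y` and the single relation
`x ^ (p+1) = (y (x ^ (r-p) y) ^ s) ^ (q+1)`. It is only used for `p ≤ r`. -/
abbrev Gp (p q r s : ℕ) : Type :=
  PresentedGroup
    ({of Gen₂.x ^ (p + 1) *
      ((of Gen₂.y * (of Gen₂.x ^ (r - p) * of Gen₂.y) ^ s) ^ (q + 1))⁻¹} : Set (FreeGroup Gen₂))

/-- The generator `x` of the group. -/
def Gp.x (p q r s : ℕ) : Gp p q r s := PresentedGroup.of Gen₂.x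

/-- The generator `y` of the group. -/
def Gp.y (p q r s : ℕ) : Gp p q r s := PresentedGroup.of Gen₂.y

/-! ### The monoid `⟨a, b, c ∣ a = b (a ^ p b) ^ q, b = c (a ^ r c) ^ s⟩⁺` -/

/-- The three generators of the monoid. -/
inductive Gen₃
  | a
  | b
  | c

open FreeMonoid in
/-- The two defining relations `a = b (a ^ p b) ^ q` and `b = c (a ^ r c) ^ s`. -/
inductive MonRel (p q r s : ℕ) : FreeMonoid Gen₃ → FreeMonoid Gen₃ → Prop
  | rel_a : MonRel p q r s (of Gen₃.a) (of Gen₃.b * (of Gen₃.a ^ p * of Gen₃.b) ^ q)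
  | rel_b : MonRel p q r s (of Gen₃.b) (of Gen₃.c * (of Gen₃.a ^ r * of Gen₃.c) ^ s)

/-- The monoid presented by `a, b, c` and the two relations above. -/
abbrev Mon (p q r s : ℕ) : Type := PresentedMonoid (MonRel p q r s)

/-- The generator `a` of the monoid. -/
def Mon.a (p q r s : ℕ) : Mon p q r s := PresentedMonoid.of _ Gen₃.a

/-- The generator `b` of the monoid. -/
def Mon.b (p q r s : ℕ) : Mon p q r s := PresentedMonoid.of _ Gen₃.b

/-- The generator `c` of the monoid. -/
def Mon.c (p q r s : ℕ) : Mon p q r s := PresentedMonoid.of _ Gen₃.c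

end OTypeMonoid

/-! With X = (a^p b)^q and Y = (a^r c)^s, the relations a = b X and b = c Y let every letter expand
to a word starting with c. Deleting this common letter shortens any derivation that touches the head
(`Deriv.cons_cons`). Induction on the number of steps gives left cancellation, and comparability of
elements with a common right-multiple. The relations are palindromic, so the mirrored statements
follow by reversal.

For `O`-type only common right-multiples are missing. If a dominates the generators, every element
left-divides a power of a. Domination comes from roots: (b a^p)^(q+1) = a^(p+1) and (c a^r)^(s+1) =
b a^r, and g ∣ w g descends from powers of w to w when g and w g have a common right-multiple
(`dvd_mul_of_dvd_pow_mul`). If r < p and q, s ≥ 1, descent on derivation length shows that c a^p and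
a^(p-r) have no common right-multiple.

In the group, y = c x^p turns the relation into those of the monoid. A monoid of `O`-type maps to a
group of fractions with trivial kernel, so its nontrivial elements give a positive cone. Two
elements generate this cone, so the ordering is isolated. -/

namespace OTypeMonoid

/-! ### Derivations for the right-triangular presentation `a = b X`, `b = c Y` -/

/-- One elementary step between words. -/
inductive Step (X Y : List Gen₃) : List Gen₃ → List Gen₃ → Prop
  | tail (x : Gen₃) {u v : List Gen₃} : Step X Y u v → Step X Y (x :: u) (x :: v)
  | ab (u : List Gen₃) : Step X Y (.a :: u) (.b :: (X ++ u))
  | ba (u : List Gen₃) : Step X Y (.b :: (X ++ u)) (.a :: u)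
  | bc (u : List Gen₃) : Step X Y (.b :: u) (.c :: (Y ++ u))
  | cb (u : List Gen₃) : Step X Y (.c :: (Y ++ u)) (.b :: u)

/-- `Deriv X Y n u v` says that `v` can be reached from `u` in at most `n` elementary steps. -/
inductive Deriv (X Y : List Gen₃) : ℕ → List Gen₃ → List Gen₃ → Prop
  | refl (n : ℕ) (u : List Gen₃) : Deriv X Y n u u
  | step {n : ℕ} {u v w : List Gen₃} : Step X Y u v → Deriv X Y n v w → Deriv X Y (n + 1) u w

/-- The word `x` with its first letter `c` deleted, after expanding `x` so that it starts
with `c`. -/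
def headRest (X Y : List Gen₃) : Gen₃ → List Gen₃
  | .a => Y ++ X
  | .b => Y
  | .c => []

variable {X Y : List Gen₃}

theorem Step.symm {u v : List Gen₃} (h : Step X Y u v) : Step X Y v u := by
  induction h with
  | tail x _ ih => exact .tail x ih
  | ab u => exact .ba u
  | ba u => exact .ab u
  | bc u => exact .cb u
  | cb u => exact .bc u

theorem Step.append_left (w : List Gen₃) {u v : List Gen₃} (h : Step X Y u v) :
    Step X Y (w ++ u) (w ++ v) := by
  induction w with
  | nil => exact h
  | cons x w ih => exact .tail x ih

theorem Step.append_right (w : List Gen₃) {u v : List Gen₃} (h : Step X Y u v) :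
    Step X Y (u ++ w) (v ++ w) := by
  induction h with
  | tail x _ ih => exact .tail x ih
  | ab u => simpa using Step.ab (X := X) (Y := Y) (u ++ w)
  | ba u => simpa using Step.ba (X := X) (Y := Y) (u ++ w)
  | bc u => simpa using Step.bc (X := X) (Y := Y) (u ++ w)
  | cb u => simpa using Step.cb (X := X) (Y := Y) (u ++ w)

theorem Deriv.mono {m n : ℕ} (hmn : m ≤ n) {u v : List Gen₃} (h : Deriv X Y m u v) :
    Deriv X Y n u v := by
  induction h generalizing n with
  | refl m u => exact .refl n u
  | step hs _ ih =>
    obtain ⟨k, rfl⟩ : ∃ k, n = k + 1 := ⟨n - 1, by omega⟩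
    exact .step hs (ih (by omega))

theorem Deriv.trans {m n : ℕ} {u v w : List Gen₃} (h : Deriv X Y m u v) (h' : Deriv X Y n v w) :
    Deriv X Y (m + n) u w := by
  induction h with
  | refl m u => exact h'.mono (by omega)
  | step hs _ ih => exact (Deriv.step hs (ih h')).mono (by omega)

theorem Deriv.symm {n : ℕ} {u v : List Gen₃} (h : Deriv X Y n u v) : Deriv X Y n v u := by
  induction h with
  | refl m u => exact .refl m u
  | step hs _ ih => exact ih.trans (Deriv.step (n := 0) hs.symm (.refl 0 _))

theorem Deriv.append_left {n : ℕ} (w : List Gen₃) {u v : List Gen₃} (h : Deriv X Y n u v) :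
    Deriv X Y n (w ++ u) (w ++ v) := by
  induction h with
  | refl m u => exact .refl m _
  | step hs _ ih => exact .step (hs.append_left w) ih

theorem Deriv.append_right {n : ℕ} (w : List Gen₃) {u v : List Gen₃} (h : Deriv X Y n u v) :
    Deriv X Y n (u ++ w) (v ++ w) := by
  induction h with
  | refl m u => exact .refl m _
  | step hs _ ih => exact .step (hs.append_right w) ih

theorem Deriv.eq_nil {n : ℕ} {u v : List Gen₃} (h : Deriv X Y n u v) (hv : v = []) : u = [] := by
  induction h with
  | refl m u => exact hv
  | step hs _ ih =>
    have := ih hv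
    cases hs <;> simp_all

/-- A derivation between nonempty words either never touches the first letter, or yields a strictly
shorter derivation after both words are expanded and their common first letter `c` is deleted. -/
theorem Deriv.cons_cons {n : ℕ} {x y : Gen₃} {u v : List Gen₃}
    (h : Deriv X Y n (x :: u) (y :: v)) :
    (x = y ∧ Deriv X Y n u v) ∨
      ∃ m < n, Deriv X Y m (headRest X Y x ++ u) (headRest X Y y ++ v) := by
  induction n generalizing x u with
  | zero =>
    cases h
    exact .inl ⟨rfl, .refl _ _⟩
  | succ n ih =>
    -- A step at the head relates words with the same expansion, so it vanishes after expanding;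
    -- this is where the count drops.
    have key : ∀ {x' : Gen₃} {u' : List Gen₃}, Deriv X Y n (x' :: u') (y :: v) →
        headRest X Y x' ++ u' = headRest X Y x ++ u →
        ∃ m < n + 1, Deriv X Y m (headRest X Y x ++ u) (headRest X Y y ++ v) := by
      intro x' u' hd e
      rw [← e]
      rcases ih hd with ⟨rfl, hd'⟩ | ⟨m, hm, hd'⟩
      · exact ⟨n, by omega, hd'.append_left _⟩
      · exact ⟨m, by omega, hd'⟩
    cases h with
    | refl => exact .inl ⟨rfl, .refl _ _⟩
    | step hs hd =>
      cases hs with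
      | tail _ hs =>
        rcases ih hd with ⟨rfl, hd'⟩ | ⟨m, hm, hd'⟩
        · exact .inl ⟨rfl, .step hs hd'⟩
        · exact .inr ⟨m + 1, by omega, .step (hs.append_left _) hd'⟩
      | ab => exact .inr (key hd (by simp [headRest]))
      | ba => exact .inr (key hd (by simp [headRest]))
      | bc => exact .inr (key hd (by simp [headRest]))
      | cb => exact .inr (key hd (by simp [headRest]))

/-- If the head is touched, the shorter derivation carries a common prefix, which the induction
hypothesis peels off letter by letter without adding steps. -/
theorem Deriv.of_cons {n : ℕ} {x : Gen₃} {u v : List Gen₃} (h : Deriv X Y n (x :: u) (x :: v)) :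
    Deriv X Y n u v := by
  induction n using Nat.strong_induction_on generalizing x u v with
  | _ n ih =>
    rcases h.cons_cons with ⟨-, h⟩ | ⟨m, hm, h⟩
    · exact h
    · have : ∀ w : List Gen₃, Deriv X Y m (w ++ u) (w ++ v) → Deriv X Y m u v := by
        intro w
        induction w with
        | nil => exact id
        | cons z w ihw => exact fun h => ihw (ih m hm h)
      exact (this _ h).mono hm.le

theorem Deriv.of_append_left {n : ℕ} {w u v : List Gen₃}
    (h : Deriv X Y n (w ++ u) (w ++ v)) : Deriv X Y n u v := by
  induction w with
  | nil => exact h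
  | cons z w ih => exact ih h.of_cons

/-- Two words with a common right-multiple are comparable for left-divisibility. -/
theorem Deriv.comparable {n : ℕ} {u u' v v' : List Gen₃}
    (h : Deriv X Y n (u ++ u') (v ++ v')) :
    ∃ k w, Deriv X Y k (u ++ w) v ∨ Deriv X Y k (v ++ w) u := by
  -- The outer induction serves derivations that touch the head; the inner one, at fixed `n`, those
  -- that do not.
  induction n using Nat.strong_induction_on generalizing u v with
  | _ n ihn =>
    induction u generalizing v with
    | nil => exact ⟨0, v, .inl (.refl _ _)⟩
    | cons x u ihu =>
      cases v with
      | nil => exact ⟨0, x :: u, .inr (.refl _ _)⟩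
      | cons y v =>
        have hc : ∀ (z : Gen₃) (t : List Gen₃),
            ∃ j, Deriv X Y j (z :: t) (.c :: (headRest X Y z ++ t)) := by
          rintro (_ | _ | _) t
          · exact ⟨2, .step (.ab t) (.step (.bc _) (by simpa [headRest] using .refl 0 _))⟩
          · exact ⟨1, .step (.bc t) (.refl 0 _)⟩
          · exact ⟨0, .refl 0 _⟩
        rcases h.cons_cons with ⟨rfl, h'⟩ | ⟨m, hm, h'⟩
        · obtain ⟨k, w, h | h⟩ := ihu h'
          · exact ⟨k, w, .inl (h.append_left [x])⟩
          · exact ⟨k, w, .inr (h.append_left [x])⟩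
        · obtain ⟨k, w, h⟩ := ihn m hm (u := headRest X Y x ++ u) (v := headRest X Y y ++ v)
            (by simpa using h')
          obtain ⟨i, hi⟩ := hc x u
          obtain ⟨j, hj⟩ := hc y v
          rcases h with h | h
          · exact ⟨_, w, .inl (((hi.append_right w).trans (by simpa using h.append_left [.c])).trans
              hj.symm)⟩
          · exact ⟨_, w, .inr (((hj.append_right w).trans (by simpa using h.append_left [.c])).trans
              hi.symm)⟩

/-! ### Consequences for the monoid -/

theorem mul_pow_mul_comm {M : Type*} [Monoid M] (u v : M) (n : ℕ) :
    u * (v * u) ^ n = (u * v) ^ n * u := by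
  induction n with
  | zero => simp
  | succ n ih => rw [pow_succ, ← mul_assoc, ih, pow_succ]; simp only [mul_assoc]

theorem mul_pow_succ {M : Type*} [Monoid M] (u v : M) (n : ℕ) :
    (u * v) ^ (n + 1) = u * (v * u) ^ n * v := by
  rw [pow_succ, ← mul_assoc, mul_pow_mul_comm]

/-- The word `(a ^ p b) ^ q`. -/
def wordX (p q : ℕ) : List Gen₃ :=
  FreeMonoid.toList ((FreeMonoid.of Gen₃.a ^ p * FreeMonoid.of Gen₃.b) ^ q)

/-- The word `(a ^ r c) ^ s`. -/
def wordY (r s : ℕ) : List Gen₃ :=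
  FreeMonoid.toList ((FreeMonoid.of Gen₃.a ^ r * FreeMonoid.of Gen₃.c) ^ s)

/-- The congruence of derivability. -/
def derivCon (X Y : List Gen₃) : Con (FreeMonoid Gen₃) where
  r u v := ∃ n, Deriv X Y n u.toList v.toList
  iseqv :=
    { refl := fun _ => ⟨0, .refl 0 _⟩
      symm := fun ⟨n, h⟩ => ⟨n, h.symm⟩
      trans := fun ⟨_, h⟩ ⟨_, h'⟩ => ⟨_, h.trans h'⟩ }
  mul' := fun ⟨_, h⟩ ⟨_, h'⟩ => ⟨_, (h.append_right _).trans (h'.append_left _)⟩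

/-- Equality in the monoid thus comes with a number of steps on which to induct. -/
theorem conGen_monRel (p q r s : ℕ) :
    conGen (MonRel p q r s) = derivCon (wordX p q) (wordY r s) := by
  apply le_antisymm
  · refine Con.conGen_le.2 ?_
    rintro _ _ (_ | _)
    · refine ⟨1, ?_⟩
      have := Step.ab (X := wordX p q) (Y := wordY r s) []
      rw [List.append_nil] at this
      exact .step this (.refl 0 _)
    · refine ⟨1, ?_⟩
      have := Step.bc (X := wordX p q) (Y := wordY r s) []
      rw [List.append_nil] at this
      exact .step this (.refl 0 _)
  · have hstep : ∀ u v, Step (wordX p q) (wordY r s) u v →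
        conGen (MonRel p q r s) (FreeMonoid.ofList u) (FreeMonoid.ofList v) := by
      have ha : ∀ u, conGen (MonRel p q r s) (FreeMonoid.ofList (.a :: u))
          (FreeMonoid.ofList (.b :: (wordX p q ++ u))) := fun u =>
        (conGen (MonRel p q r s)).mul (ConGen.Rel.of _ _ .rel_a)
          ((conGen _).refl (FreeMonoid.ofList u))
      have hb : ∀ u, conGen (MonRel p q r s) (FreeMonoid.ofList (.b :: u))
          (FreeMonoid.ofList (.c :: (wordY r s ++ u))) := fun u =>
        (conGen (MonRel p q r s)).mul (ConGen.Rel.of _ _ .rel_b)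
          ((conGen _).refl (FreeMonoid.ofList u))
      intro u v h
      induction h with
      | tail x _ ih => exact (conGen _).mul ((conGen _).refl (FreeMonoid.of x)) ih
      | ab u => exact ha u
      | ba u => exact (conGen _).symm (ha u)
      | bc u => exact hb u
      | cb u => exact (conGen _).symm (hb u)
    rintro u v ⟨n, h⟩
    have : ∀ n (u v : List Gen₃), Deriv (wordX p q) (wordY r s) n u v →
        conGen (MonRel p q r s) (FreeMonoid.ofList u) (FreeMonoid.ofList v) := by
      intro n u v h
      induction h with
      | refl => exact (conGen _).refl _
      | step hs _ ih => exact (conGen _).trans (hstep _ _ hs) ih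
    exact this _ _ _ h

namespace Mon

variable {p q r s : ℕ}

theorem mk_eq_mk {u v : FreeMonoid Gen₃} :
    PresentedMonoid.mk (MonRel p q r s) u = PresentedMonoid.mk (MonRel p q r s) v ↔
      ∃ n, Deriv (wordX p q) (wordY r s) n u.toList v.toList := by
  rw [PresentedMonoid.mk_eq_mk_iff, conGen_monRel]
  rfl

theorem a_eq : a p q r s = b p q r s * (a p q r s ^ p * b p q r s) ^ q := by
  have := PresentedMonoid.mk_eq_mk_of_rel (MonRel.rel_a (p := p) (q := q) (r := r) (s := s))
  rw [map_mul, map_pow, map_mul, map_pow] at this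
  exact this

theorem b_eq : b p q r s = c p q r s * (a p q r s ^ r * c p q r s) ^ s := by
  have := PresentedMonoid.mk_eq_mk_of_rel (MonRel.rel_b (p := p) (q := q) (r := r) (s := s))
  rw [map_mul, map_pow, map_mul, map_pow] at this
  exact this

theorem mul_left_cancel' (h g g' : Mon p q r s) (e : h * g = h * g') : g = g' := by
  induction h using PresentedMonoid.inductionOn with | _ h
  induction g using PresentedMonoid.inductionOn with | _ g
  induction g' using PresentedMonoid.inductionOn with | _ g'
  rw [← map_mul, ← map_mul, mk_eq_mk] at e
  obtain ⟨n, e⟩ := e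
  exact mk_eq_mk.2 ⟨n, Deriv.of_append_left (w := h.toList) e⟩

theorem eq_one_of_mul_eq_one (g h : Mon p q r s) (e : g * h = 1) : g = 1 := by
  induction g using PresentedMonoid.inductionOn with | _ g
  induction h using PresentedMonoid.inductionOn with | _ h
  rw [← map_mul, ← map_one (PresentedMonoid.mk (MonRel p q r s)), mk_eq_mk] at e
  obtain ⟨n, e⟩ := e
  have : g.toList ++ h.toList = [] := e.eq_nil rfl
  have hg : g = 1 := (List.append_eq_nil_iff.1 this).1
  rw [hg, map_one]

theorem comparable (g h : Mon p q r s) (hc : ∃ g' h', g * g' = h * h') : g ∣ h ∨ h ∣ g := by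
  obtain ⟨g', h', e⟩ := hc
  induction g using PresentedMonoid.inductionOn with | _ g
  induction h using PresentedMonoid.inductionOn with | _ h
  induction g' using PresentedMonoid.inductionOn with | _ g'
  induction h' using PresentedMonoid.inductionOn with | _ h'
  rw [← map_mul, ← map_mul, mk_eq_mk] at e
  obtain ⟨n, e⟩ := e
  obtain ⟨k, w, e | e⟩ :=
    Deriv.comparable (u := g.toList) (v := h.toList) (u' := g'.toList) (v' := h'.toList) e
  · refine .inl ⟨PresentedMonoid.mk _ (FreeMonoid.ofList w), ?_⟩
    rw [← map_mul]
    exact (mk_eq_mk.2 ⟨k, e⟩).symm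
  · refine .inr ⟨PresentedMonoid.mk _ (FreeMonoid.ofList w), ?_⟩
    rw [← map_mul]
    exact (mk_eq_mk.2 ⟨k, e⟩).symm

/-- Induction on the length of a word in the generators. -/
theorem induction_gen {P : Mon p q r s → Prop} (g : Mon p q r s) (one : P 1)
    (ha : ∀ g, P g → P (a p q r s * g)) (hb : ∀ g, P g → P (b p q r s * g))
    (hc : ∀ g, P g → P (c p q r s * g)) : P g := by
  induction g using PresentedMonoid.inductionOn with | _ g
  induction g using FreeMonoid.inductionOn' with
  | one => simpa using one
  | of_mul x g ih =>
    rw [map_mul]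
    cases x
    exacts [ha _ ih, hb _ ih, hc _ ih]

/-! ### The mirror anti-automorphism -/

/-- The anti-automorphism of the monoid that fixes the generators. -/
def mirror (p q r s : ℕ) : Mon p q r s →* (Mon p q r s)ᵐᵒᵖ :=
  PresentedMonoid.lift (M := (Mon p q r s)ᵐᵒᵖ)
    (fun x => MulOpposite.op (PresentedMonoid.of (MonRel p q r s) x)) (by
      rintro _ _ (_ | _)
      · apply MulOpposite.unop_injective
        simp only [map_mul, map_pow, FreeMonoid.lift_eval_of, MulOpposite.unop_mul,
          MulOpposite.unop_pow, MulOpposite.unop_op]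
        -- The reversed right-hand side is (b a^p)^q b, which equals b (a^p b)^q.
        rw [← mul_pow_mul_comm]
        exact a_eq
      · apply MulOpposite.unop_injective
        simp only [map_mul, map_pow, FreeMonoid.lift_eval_of, MulOpposite.unop_mul,
          MulOpposite.unop_pow, MulOpposite.unop_op]
        rw [← mul_pow_mul_comm]
        exact b_eq)

/-- The mirror image of an element of the monoid. -/
def rev (g : Mon p q r s) : Mon p q r s := (mirror p q r s g).unop

theorem rev_mul (g h : Mon p q r s) : rev (g * h) = rev h * rev g := by simp [rev]

theorem rev_one : rev (1 : Mon p q r s) = 1 := by simp [rev]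

theorem rev_pow (g : Mon p q r s) (n : ℕ) : rev (g ^ n) = rev g ^ n := by simp [rev]

theorem rev_a : rev (a p q r s) = a p q r s := rfl

theorem rev_b : rev (b p q r s) = b p q r s := rfl

theorem rev_c : rev (c p q r s) = c p q r s := rfl

theorem rev_rev (g : Mon p q r s) : rev (rev g) = g := by
  induction g using induction_gen with
  | one => rw [rev_one, rev_one]
  | ha g ih => rw [rev_mul, rev_mul, ih, rev_a, rev_a]
  | hb g ih => rw [rev_mul, rev_mul, ih, rev_b, rev_b]
  | hc g ih => rw [rev_mul, rev_mul, ih, rev_c, rev_c]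

theorem rightDivides_of_rev_dvd {g h : Mon p q r s} (hd : rev g ∣ rev h) : RightDivides g h := by
  obtain ⟨k, hk⟩ := hd
  exact ⟨rev k, by rw [← rev_rev h, hk, rev_mul, rev_rev]⟩

theorem isOType_of_isRightOType (h : IsRightOType (Mon p q r s)) : IsOType (Mon p q r s) := by
  refine ⟨h, ⟨fun k g g' e => ?_, h.eq_one, fun g g' => ?_⟩⟩
  · have := congrArg rev e
    rw [rev_mul, rev_mul] at this
    rw [← rev_rev g, h.cancel _ _ _ this, rev_rev]
  · exact (h.total (rev g) (rev g')).imp rightDivides_of_rev_dvd rightDivides_of_rev_dvd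

theorem dominates_of_rightDominates {δ g : Mon p q r s} (hδ : rev δ = δ) (hg : rev g = g)
    (h : RightDominates δ g) : Dominates δ g := by
  refine ⟨h, fun n => rightDivides_of_rev_dvd ?_⟩
  rw [rev_mul, rev_pow, rev_pow, hδ, hg]
  exact h n

end Mon

/-! ### Domination -/

section Root

variable {M : Type*} [Monoid M]

theorem pow_mul_eq_mul_pow_of_eq {w g u : M} (h : g = w * g * u) (n : ℕ) :
    g = w ^ n * g * u ^ n := by
  induction n with
  | zero => simp
  | succ n ih =>
    calc g = w * g * u := h
      _ = w * (w ^ n * g * u ^ n) * u := by rw [← ih]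
      _ = _ := by rw [pow_succ' w, pow_succ u]; simp only [mul_assoc]

/-- If `g` left-divides `w ^ (n + 1) g`, and `g` and `w g` have a common right-multiple, then `g`
left-divides `w g`. -/
theorem dvd_mul_of_dvd_pow_mul
    (hcancel : ∀ h g g' : M, h * g = h * g' → g = g') (hone : ∀ g h : M, g * h = 1 → g = 1)
    (hcomp : ∀ g h : M, (∃ g' h', g * g' = h * h') → g ∣ h ∨ h ∣ g)
    {w g : M} {n : ℕ} (hn : g ∣ w ^ (n + 1) * g)
    (hc : ∃ g' h', g * g' = w * g * h') : g ∣ w * g := by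
  rcases hcomp _ _ hc with h | ⟨u, hu⟩
  · exact h
  · obtain ⟨v, hv⟩ := hn
    -- Here g = w g u, hence g = w^(n+1) g u^(n+1) = g v u^(n+1). Cancelling g gives v u^(n+1) = 1,
    -- which forces u = 1.
    have h1 := pow_mul_eq_mul_pow_of_eq hu (n + 1)
    rw [hv] at h1
    have h2 : v * u ^ (n + 1) = 1 :=
      (hcancel g _ _ (by rw [mul_one, ← mul_assoc]; exact h1)).symm
    have hu1 : v = 1 := hone _ _ h2
    rw [hu1, one_mul, pow_succ'] at h2
    rw [hone _ _ h2, mul_one] at hu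
    exact ⟨1, by rw [mul_one]; exact hu.symm⟩

/-- If `δ ^ k` left-divides `w ^ (n + 1) δ ^ k` for all `k`, and `δ ^ m` left-divides `w δ ^ m`,
then `δ ^ k` left-divides `w δ ^ k` for all `k ≤ m`. -/
theorem pow_dvd_mul_pow_of_le
    (hcancel : ∀ h g g' : M, h * g = h * g' → g = g') (hone : ∀ g h : M, g * h = 1 → g = 1)
    (hcomp : ∀ g h : M, (∃ g' h', g * g' = h * h') → g ∣ h ∨ h ∣ g)
    {w δ : M} {n : ℕ} (hn : ∀ k, δ ^ k ∣ w ^ (n + 1) * δ ^ k)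
    {k m : ℕ} (hkm : k ≤ m) (hm : δ ^ m ∣ w * δ ^ m) : δ ^ k ∣ w * δ ^ k := by
  apply dvd_mul_of_dvd_pow_mul hcancel hone hcomp (hn k)
  obtain ⟨i, rfl⟩ := Nat.exists_eq_add_of_le hkm
  obtain ⟨v, hv⟩ := hm
  refine ⟨δ ^ i * v, δ ^ i, ?_⟩
  rw [← mul_assoc, ← pow_add, ← hv, pow_add, mul_assoc]

/-- If a power of `w` is a power of `δ`, then `δ ^ k` left-divides `w δ ^ k`. -/
theorem pow_dvd_mul_pow_of_pow_eq
    (hcancel : ∀ h g g' : M, h * g = h * g' → g = g') (hone : ∀ g h : M, g * h = 1 → g = 1)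
    (hcomp : ∀ g h : M, (∃ g' h', g * g' = h * h') → g ∣ h ∨ h ∣ g)
    {w δ : M} {n m : ℕ} (h : w ^ (n + 1) = δ ^ (m + 1)) (k : ℕ) :
    δ ^ k ∣ w * δ ^ k := by
  -- The exponent (m+1) k is at least k, and δ^((m+1) k) is a power of w, so it commutes with w.
  refine pow_dvd_mul_pow_of_le hcancel hone hcomp (n := n) (m := (m + 1) * k)
    (fun k => ?_) (by nlinarith) ?_
  · rw [h, ← pow_add, add_comm, pow_add]
    exact Dvd.intro _ rfl
  · have : Commute w (δ ^ ((m + 1) * k)) := by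
      rw [pow_mul, ← h]
      exact ((Commute.refl w).pow_right _).pow_right _
    rw [this.eq]
    exact Dvd.intro _ rfl

end Root

/-- The condition g ∣ w g plays the part of g⁻¹ w g ≥ 1, hence its stability under products. -/
theorem dvd_mul_trans_of_dvd {M : Type*} [Monoid M] {g w w' : M} (h : g ∣ w * g) (h' : g ∣ w' * g) :
    g ∣ w * w' * g := by
  obtain ⟨u, hu⟩ := h'
  obtain ⟨v, hv⟩ := h
  exact ⟨v * u, by rw [mul_assoc, hu, ← mul_assoc, hv, mul_assoc]⟩

theorem dvd_pow_mul_of_dvd {M : Type*} [Monoid M] {g w : M} (h : g ∣ w * g) (n : ℕ) :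
    g ∣ w ^ n * g := by
  induction n with
  | zero => simp
  | succ n ih => rw [pow_succ]; exact dvd_mul_trans_of_dvd ih h

/-- If `δ ^ k` left-divides `g δ ^ m δ ^ k` for all `k`, it left-divides `δ ^ m g δ ^ k`. -/
theorem pow_dvd_pow_mul_mul_pow {M : Type*} [Monoid M] {g δ : M} {m : ℕ}
    (h : ∀ k, δ ^ k ∣ g * δ ^ m * δ ^ k) (k : ℕ) : δ ^ k ∣ δ ^ m * g * δ ^ k := by
  rcases le_total k m with hk | hk
  · rw [mul_assoc]
    exact (pow_dvd_pow δ hk).mul_right _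
  · obtain ⟨i, rfl⟩ := Nat.exists_eq_add_of_le hk
    obtain ⟨v, hv⟩ := h i
    refine ⟨v, ?_⟩
    rw [pow_add, mul_assoc, mul_assoc, ← hv]
    simp only [mul_assoc]

/-! ### Domination by a, and the `O`-type property -/

namespace Mon

variable {p q r s : ℕ}

theorem pow_b_a : (b p q r s * a p q r s ^ p) ^ (q + 1) = a p q r s ^ (p + 1) := by
  rw [mul_pow_succ, ← a_eq, pow_succ']

theorem pow_c_a : (c p q r s * a p q r s ^ r) ^ (s + 1) = b p q r s * a p q r s ^ r := by
  rw [mul_pow_succ, ← b_eq]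

theorem pow_a_dvd_b (k : ℕ) :
    a p q r s ^ k ∣ b p q r s * a p q r s ^ p * a p q r s ^ k :=
  pow_dvd_mul_pow_of_pow_eq mul_left_cancel' eq_one_of_mul_eq_one comparable pow_b_a k

theorem pow_a_dvd_c (h : p ≤ r ∨ q = 0) (k : ℕ) :
    a p q r s ^ k ∣ c p q r s * a p q r s ^ r * a p q r s ^ k := by
  -- In these cases c a^r is itself a root of a^(r+1), through (b a^r)^(q+1).
  by_cases hpr : r = p ∨ q = 0
  · have : (c p q r s * a p q r s ^ r) ^ (((s + 1) * (q + 1) - 1) + 1) = a p q r s ^ (r + 1) := by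
      rw [Nat.sub_add_cancel (by nlinarith), pow_mul, pow_c_a]
      rcases hpr with rfl | rfl
      · exact pow_b_a
      · rw [zero_add, pow_one, pow_succ']
        nth_rw 2 [a_eq]
        rw [pow_zero, mul_one]
    exact pow_dvd_mul_pow_of_pow_eq mul_left_cancel' eq_one_of_mul_eq_one comparable this k
  · obtain ⟨e, rfl⟩ : ∃ e, r = p + (e + 1) := ⟨r - p - 1, by omega⟩
    have hpow (k : ℕ) : (c p q (p + (e + 1)) s * a p q (p + (e + 1)) s ^ (p + (e + 1))) ^ (s + 1) *
        a p q (p + (e + 1)) s ^ k = b p q (p + (e + 1)) s * a p q (p + (e + 1)) s ^ p *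
        a p q (p + (e + 1)) s ^ (e + 1 + k) := by
      rw [pow_c_a, pow_add _ p, pow_add _ (e + 1)]
      simp only [mul_assoc]
    set α := a p q (p + (e + 1)) s
    set z := b p q (p + (e + 1)) s * α ^ p
    set w := c p q (p + (e + 1)) s * α ^ (p + (e + 1))
    have hroot (k : ℕ) : α ^ k ∣ w ^ (s + 1) * α ^ k := by
      rw [hpow]
      exact (pow_dvd_pow α (by omega)).trans (pow_a_dvd_b _)
    -- Now w^(s+1) = z α^(e+1). Its surplus of e+1 letters lets common right-multiples be built in
    -- steps of that size.
    have hmul (i : ℕ) : α ^ ((e + 1) * i) ∣ w * α ^ ((e + 1) * i) := by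
      induction i with
      | zero => simp
      | succ i ih =>
        apply dvd_mul_of_dvd_pow_mul mul_left_cancel' eq_one_of_mul_eq_one comparable (hroot _)
        have hk : (e + 1) * (i + 1) = e + 1 + (e + 1) * i := by ring
        obtain ⟨v, hv⟩ := pow_a_dvd_b (p := p) (q := q) (r := p + (e + 1)) (s := s)
          ((e + 1) * (i + 1))
        obtain ⟨t, ht⟩ := ih
        -- Put A = α^((e+1)(i+1)) and B = α^((e+1) i). From z A = A v, w B = B t and w^(s+1) B = z
        -- A, the element w^(s+2) B equals both A v t and w A v.
        refine ⟨v * t, v, ?_⟩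
        calc α ^ ((e + 1) * (i + 1)) * (v * t) = z * α ^ ((e + 1) * (i + 1)) * t := by
              rw [← mul_assoc, ← hv]
          _ = w ^ (s + 1) * (α ^ ((e + 1) * i) * t) := by rw [hk, ← hpow, mul_assoc]
          _ = w * (w ^ (s + 1) * α ^ ((e + 1) * i)) := by
              rw [← ht, ← mul_assoc, ← pow_succ, pow_succ', mul_assoc]
          _ = w * (z * α ^ ((e + 1) * (i + 1))) := by rw [hpow, hk]
          _ = w * α ^ ((e + 1) * (i + 1)) * v := by
              rw [mul_assoc w]
              exact congrArg (w * ·) hv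
    exact pow_dvd_mul_pow_of_le mul_left_cancel' eq_one_of_mul_eq_one comparable hroot
      (m := (e + 1) * k) (by nlinarith) (hmul k)

theorem rightDominates_a_a : RightDominates (a p q r s) (a p q r s) := fun n => by
  rw [pow_succ']

theorem pow_a_dvd_wordX (n : ℕ) :
    a p q r s ^ n ∣ (a p q r s ^ p * b p q r s) ^ q * a p q r s ^ n :=
  dvd_pow_mul_of_dvd (pow_dvd_pow_mul_mul_pow pow_a_dvd_b n) q

/-- Expanding the leading a of a^(n+1) and dropping b leaves a^n ∣ (a^p b)^q a^n. -/
theorem rightDominates_a_b : RightDominates (a p q r s) (b p q r s) := fun n => by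
  rw [pow_succ']
  nth_rw 2 [a_eq]
  rw [mul_assoc]
  exact mul_dvd_mul_left _ (pow_a_dvd_wordX n)

theorem rightDominates_a_c (h : p ≤ r ∨ q = 0) : RightDominates (a p q r s) (c p q r s) :=
  fun n => by
  rw [pow_succ']
  nth_rw 2 [a_eq]
  nth_rw 1 [b_eq]
  rw [mul_assoc, mul_assoc]
  refine mul_dvd_mul_left _ ?_
  rw [← mul_assoc]
  exact dvd_mul_trans_of_dvd
    (dvd_pow_mul_of_dvd (pow_dvd_pow_mul_mul_pow (pow_a_dvd_c h) n) s) (pow_a_dvd_wordX n)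

theorem dominates_gen (h : p ≤ r ∨ q = 0) :
    Dominates (a p q r s) (a p q r s) ∧ Dominates (a p q r s) (b p q r s) ∧
      Dominates (a p q r s) (c p q r s) :=
  ⟨dominates_of_rightDominates rev_a rev_a rightDominates_a_a,
    dominates_of_rightDominates rev_a rev_b rightDominates_a_b,
    dominates_of_rightDominates rev_a rev_c (rightDominates_a_c h)⟩

/-- Domination absorbs one letter at a time: g ∣ a^n gives x g ∣ x a^n ∣ a^(n+1). -/
theorem exists_dvd_pow_a (h : p ≤ r ∨ q = 0) (g : Mon p q r s) : ∃ n, g ∣ a p q r s ^ n := by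
  induction g using induction_gen with
  | one => exact ⟨0, one_dvd _⟩
  | ha g ih =>
    obtain ⟨n, hn⟩ := ih
    exact ⟨n + 1, (mul_dvd_mul_left _ hn).trans (rightDominates_a_a n)⟩
  | hb g ih =>
    obtain ⟨n, hn⟩ := ih
    exact ⟨n + 1, (mul_dvd_mul_left _ hn).trans (rightDominates_a_b n)⟩
  | hc g ih =>
    obtain ⟨n, hn⟩ := ih
    exact ⟨n + 1, (mul_dvd_mul_left _ hn).trans (rightDominates_a_c h n)⟩

theorem isOType (h : p ≤ r ∨ q = 0) : IsOType (Mon p q r s) := by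
  refine isOType_of_isRightOType ⟨mul_left_cancel', fun g hg => ?_, fun g g' => comparable _ _ ?_⟩
  · obtain ⟨k, hk⟩ := hg.exists_right_inv
    exact eq_one_of_mul_eq_one g k hk
  · obtain ⟨m, hm⟩ := exists_dvd_pow_a h g
    obtain ⟨n, hn⟩ := exists_dvd_pow_a h g'
    obtain ⟨u, hu⟩ := hm.trans (pow_dvd_pow _ (le_max_left m n))
    obtain ⟨v, hv⟩ := hn.trans (pow_dvd_pow _ (le_max_right m n))
    exact ⟨u, v, by rw [← hu, hv]⟩

end Mon

/-! ### Elements without common right-multiple -/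

theorem wordY_add (r m n : ℕ) : wordY r (m + n) = wordY r m ++ wordY r n := by
  rw [wordY, pow_add, FreeMonoid.toList_mul]
  rfl

theorem toList_of_pow (x : Gen₃) (n : ℕ) :
    FreeMonoid.toList (FreeMonoid.of x ^ n) = List.replicate n x := by
  induction n with
  | zero => rfl
  | succ n ih => rw [pow_succ', FreeMonoid.toList_mul, ih]; rfl

theorem wordY_succ (r n : ℕ) : wordY r (n + 1) = List.replicate r .a ++ .c :: wordY r n := by
  rw [wordY, pow_succ', FreeMonoid.toList_mul, FreeMonoid.toList_mul, toList_of_pow]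
  simp [wordY]

theorem wordX_succ (p n : ℕ) : wordX p (n + 1) = List.replicate p .a ++ .b :: wordX p n := by
  rw [wordX, pow_succ', FreeMonoid.toList_mul, FreeMonoid.toList_mul, toList_of_pow]
  simp [wordX]

/-- If `p = r + d + 1`, the elements `c (a ^ r c) ^ j a ^ p` and `a ^ (d + 1)` have no common
right-multiple when `j ≤ s`: a derivation would yield a shorter one of the same form. -/
theorem not_deriv_of_lt {r d q s n j : ℕ} (hj : j ≤ s) {u v : List Gen₃} :
    ¬ Deriv (wordX (r + (d + 1)) (q + 1)) (wordY r (s + 1)) n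
      (.c :: (wordY r j ++ (List.replicate (r + (d + 1)) .a ++ u)))
      (.a :: (List.replicate d .a ++ v)) := by
  intro h
  induction n using Nat.strong_induction_on generalizing j u v with
  | _ n ih =>
    rcases h.cons_cons with ⟨e, -⟩ | ⟨m, hm, h'⟩
    · cases e
    · have hY : wordY r (s + 1) =
          wordY r j ++ (List.replicate r .a ++ .c :: wordY r (s - j)) := by
        rw [← wordY_succ, ← wordY_add]
        congr 1
        omega
      have e1 : headRest (wordX (r + (d + 1)) (q + 1)) (wordY r (s + 1)) .c ++
          (wordY r j ++ (List.replicate (r + (d + 1)) .a ++ u)) =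
          wordY r j ++ (List.replicate r .a ++ (.a :: (List.replicate d .a ++ u))) := by
        rw [List.replicate_add, List.replicate_succ]
        simp [headRest]
      have e2 : headRest (wordX (r + (d + 1)) (q + 1)) (wordY r (s + 1)) .a ++
          (List.replicate d .a ++ v) =
          wordY r j ++ (List.replicate r .a ++ (.c :: (wordY r (s - j) ++
            (List.replicate (r + (d + 1)) .a ++
              .b :: (wordX (r + (d + 1)) q ++ (List.replicate d .a ++ v)))))) := by
        rw [headRest, hY, wordX_succ]
        simp only [List.append_assoc, List.cons_append]
      rw [e1, e2] at h'
      exact ih m hm (Nat.sub_le s j) h'.of_append_left.of_append_left.symm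

namespace Mon

theorem not_isOType {p q r s : ℕ} (h : r < p) (hq : 1 ≤ q) (hs : 1 ≤ s) :
    ¬ IsOType (Mon p q r s) := by
  obtain ⟨d, rfl⟩ : ∃ d, p = r + (d + 1) := ⟨p - r - 1, by omega⟩
  obtain ⟨q, rfl⟩ : ∃ q', q = q' + 1 := ⟨q - 1, by omega⟩
  obtain ⟨s, rfl⟩ : ∃ s', s = s' + 1 := ⟨s - 1, by omega⟩
  intro hO
  let rel := MonRel (r + (d + 1)) (q + 1) r (s + 1)
  let g : FreeMonoid Gen₃ := FreeMonoid.ofList (.c :: List.replicate (r + (d + 1)) .a)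
  let h : FreeMonoid Gen₃ := FreeMonoid.ofList (.a :: List.replicate d .a)
  have key : ∀ u v : Mon (r + (d + 1)) (q + 1) r (s + 1),
      PresentedMonoid.mk rel g * u ≠ PresentedMonoid.mk rel h * v := by
    intro u v e
    induction u using PresentedMonoid.inductionOn with | _ u
    induction v using PresentedMonoid.inductionOn with | _ v
    rw [← map_mul, ← map_mul, mk_eq_mk] at e
    obtain ⟨n, e⟩ := e
    exact not_deriv_of_lt (j := 0) (Nat.zero_le s) (u := u.toList) (v := v.toList) e
  rcases hO.1.total (PresentedMonoid.mk rel g) (PresentedMonoid.mk rel h) with ⟨k, hk⟩ | ⟨k, hk⟩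
  · exact key k 1 (by rw [mul_one, hk])
  · exact key 1 k (by rw [mul_one, hk])

end Mon

/-! ### The group of fractions -/

/-- A monoid of `O`-type embeds in a group; here only the triviality of the kernel is stated. -/
theorem IsOType.exists_group_hom.{v} {M : Type v} [Monoid M] (hM : IsOType M) :
    ∃ (K : Type v) (_ : Group K) (f : M →* K), ∀ m, f m = 1 → m = 1 := by
  have hore : ∀ (m : M) (n : (⊤ : Submonoid M)), ∃ (t : M) (u : (⊤ : Submonoid M)),
      (u : M) * m = t * n := by
    intro m n
    rcases hM.2.total m n with ⟨k, hk⟩ | ⟨k, hk⟩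
    · exact ⟨1, ⟨k, trivial⟩, by rw [one_mul, hk]⟩
    · exact ⟨k, 1, by rw [hk, Submonoid.coe_one, one_mul]⟩
  choose num den hnd using hore
  let _ : OreLocalization.OreSet (⊤ : Submonoid M) :=
    { ore_right_cancel := fun m n k e => ⟨1, by rw [hM.2.cancel _ _ _ e]⟩
      oreNum := num
      oreDenom := den
      ore_eq := hnd }
  -- Every element is a denominator, so every numerator is a unit and the unit group can serve as
  -- target.
  refine ⟨(OreLocalization (⊤ : Submonoid M) M)ˣ, inferInstance,
    { toFun := fun m => OreLocalization.numeratorUnit (⟨m, trivial⟩ : (⊤ : Submonoid M))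
      map_one' := Units.ext (map_one OreLocalization.numeratorHom)
      map_mul' := fun m n => Units.ext (map_mul OreLocalization.numeratorHom m n) },
    fun m hm => ?_⟩
  have h1 : OreLocalization.numeratorHom (S := (⊤ : Submonoid M)) m =
      OreLocalization.numeratorHom 1 := by
    rw [map_one]
    exact congrArg Units.val hm
  rw [OreLocalization.numeratorHom_apply, OreLocalization.numeratorHom_apply,
    OreLocalization.oreDiv_eq_iff] at h1
  obtain ⟨u, v, h1, h2⟩ := h1
  simp only [smul_eq_mul, Submonoid.smul_def, Submonoid.coe_one, mul_one] at h1 h2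
  refine hM.1.cancel v m 1 ?_
  rw [mul_one, ← h1, h2]

/-- The left-invariant ordering with a given positive cone. -/
def LeftOrdering.ofCone {G : Type*} [Group G] (P : Subsemigroup G) (h1 : (1 : G) ∉ P)
    (htot : ∀ g : G, g ∈ P ∨ g = 1 ∨ g⁻¹ ∈ P) : LeftOrdering G where
  lt g h := g⁻¹ * h ∈ P
  irrefl g := by simpa using h1
  trans g h k hgh hhk := by simpa [mul_assoc] using P.mul_mem hgh hhk
  trichotomous g h := by
    rcases htot (g⁻¹ * h) with H | H | H
    · exact .inl H
    · exact .inr (.inl (inv_mul_eq_one.1 H))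
    · exact .inr (.inr (by simpa using H))
  mul_left h g g' H := by simpa [mul_assoc] using H

theorem LeftOrdering.positiveCone_ofCone {G : Type*} [Group G] (P : Subsemigroup G)
    (h1 : (1 : G) ∉ P) (htot : ∀ g : G, g ∈ P ∨ g = 1 ∨ g⁻¹ ∈ P) :
    (LeftOrdering.ofCone P h1 htot).positiveCone = P := by
  ext g
  simp [LeftOrdering.positiveCone, LeftOrdering.ofCone]

theorem LeftOrdering.lt_iff {G : Type*} [Group G] (L : LeftOrdering G) (g h : G) :
    L.lt g h ↔ g⁻¹ * h ∈ L.positiveCone := by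
  constructor
  · intro H
    simpa [LeftOrdering.positiveCone] using L.mul_left g⁻¹ _ _ H
  · intro H
    simpa using L.mul_left g _ _ (show L.lt 1 (g⁻¹ * h) from H)

/-- By trichotomy, positive cones of left-invariant orderings are never strictly nested. -/
theorem LeftOrdering.eq_of_positiveCone_subset {G : Type*} [Group G] {L L' : LeftOrdering G}
    (h : L.positiveCone ⊆ L'.positiveCone) : L' = L := by
  have hsub : ∀ g k, L.lt g k → L'.lt g k := fun g k hgk =>
    (L'.lt_iff g k).2 (h ((L.lt_iff g k).1 hgk))
  ext g k
  refine ⟨fun hgk => ?_, hsub g k⟩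
  rcases L.trichotomous g k with H | rfl | H
  · exact H
  · exact (L'.irrefl _ hgk).elim
  · exact (L'.irrefl _ (L'.trans _ _ _ hgk (hsub _ _ H))).elim

/-- The orderings that make a given element positive form an open set. -/
theorem LeftOrdering.isOpen_lt {G : Type*} [Group G] (g h : G) :
    IsOpen {L : LeftOrdering G | L.lt g h} := by
  classical
  refine isOpen_induced_iff.2 ⟨{f | f (g, h) = true}, ?_, ?_⟩
  · exact (isOpen_discrete ({true} : Set Bool)).preimage
      (continuous_apply (A := fun _ : G × G => Bool) (g, h))
  · ext L
    simp

/-- An ordering whose positive cone is generated by two elements is isolated. -/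
theorem LeftOrdering.isolated_of_closure_pair {G : Type*} [Group G] (L : LeftOrdering G) (g h : G)
    (hL : L.positiveCone = (Subsemigroup.closure {g, h} : Set G)) : L.Isolated := by
  have : ({L} : Set (LeftOrdering G)) = {L' | L'.lt 1 g} ∩ {L' | L'.lt 1 h} := by
    ext L'
    simp only [Set.mem_singleton_iff, Set.mem_inter_iff, Set.mem_ofPred_eq]
    constructor
    · rintro rfl
      have : ∀ k ∈ ({g, h} : Set G), k ∈ L'.positiveCone := fun k hk => by
        rw [hL]
        exact Subsemigroup.subset_closure hk
      exact ⟨this g (by simp), this h (by simp)⟩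
    · rintro ⟨hg, hh⟩
      refine eq_of_positiveCone_subset ?_
      rw [hL]
      let P : Subsemigroup G :=
        { carrier := L'.positiveCone
          mul_mem' := fun {k l} hk hl => L'.trans _ _ _ hk (by simpa using L'.mul_left k _ _ hl) }
      refine (Subsemigroup.closure_le (S := P)).2 ?_
      rintro k (rfl | rfl)
      exacts [hg, hh]
  rw [Isolated, this]
  exact (isOpen_lt 1 g).inter (isOpen_lt 1 h)

/-! ### The homomorphism from the monoid to the group -/

theorem mul_pow_mul_pow_sub {M : Type*} [Monoid M] (x c : M) {p r : ℕ} (h : p ≤ r) (s : ℕ) :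
    c * x ^ p * (x ^ (r - p) * (c * x ^ p)) ^ s = c * (x ^ r * c) ^ s * x ^ p := by
  obtain ⟨e, rfl⟩ := Nat.exists_eq_add_of_le h
  rw [Nat.add_sub_cancel_left, mul_assoc, ← mul_assoc (x ^ e), mul_pow_mul_comm, pow_add,
    mul_assoc (x ^ p), mul_assoc]

variable {p q r s : ℕ}

theorem Gp.relation :
    Gp.x p q r s ^ (p + 1) =
      (Gp.y p q r s * (Gp.x p q r s ^ (r - p) * Gp.y p q r s) ^ s) ^ (q + 1) :=
  mul_inv_eq_one.1 (PresentedGroup.one_of_mem (Set.mem_singleton _))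

/-- The element `y x ^ (-p)` of the group. -/
def Gp.c (p q r s : ℕ) : Gp p q r s := Gp.y p q r s * (Gp.x p q r s ^ p)⁻¹

/-- The element of the group that corresponds to the generator `b` of the monoid. -/
def Gp.b (p q r s : ℕ) : Gp p q r s := Gp.c p q r s * (Gp.x p q r s ^ r * Gp.c p q r s) ^ s

/-- Substituting y = c x^p turns the relation into x^(p+1) = (b x^p)^(q+1) = b (x^p b)^q x^p, and
x^p cancels. As p ≤ r, the subtraction r - p is not truncated. -/
theorem Gp.x_eq (h : p ≤ r) :
    Gp.x p q r s = Gp.b p q r s * (Gp.x p q r s ^ p * Gp.b p q r s) ^ q := by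
  have hy : Gp.y p q r s = Gp.c p q r s * Gp.x p q r s ^ p := by simp [Gp.c]
  have := Gp.relation (p := p) (q := q) (r := r) (s := s)
  rw [hy, mul_pow_mul_pow_sub _ _ h, ← Gp.b, mul_pow_succ (Gp.b p q r s),
    pow_succ' (Gp.x p q r s)] at this
  exact mul_right_cancel this

/-- The homomorphism from the monoid to the group. -/
def Mon.toGp (q s : ℕ) (h : p ≤ r) : Mon p q r s →* Gp p q r s :=
  PresentedMonoid.lift
    (fun
      | .a => Gp.x p q r s
      | .b => Gp.b p q r s
      | .c => Gp.c p q r s) (by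
      rintro _ _ (_ | _)
      · simpa only [map_mul, map_pow, FreeMonoid.lift_eval_of] using Gp.x_eq h
      · simp only [map_mul, map_pow, FreeMonoid.lift_eval_of, Gp.b])

theorem Mon.toGp_a (h : p ≤ r) : Mon.toGp q s h (Mon.a p q r s) = Gp.x p q r s := rfl

theorem Mon.toGp_b (h : p ≤ r) : Mon.toGp q s h (Mon.b p q r s) = Gp.b p q r s := rfl

theorem Mon.toGp_c (h : p ≤ r) : Mon.toGp q s h (Mon.c p q r s) = Gp.c p q r s := rfl

/-- The map to the group of fractions respects the relation of `Gp`, so it factors through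
`Mon.toGp`, which inherits the trivial kernel. -/
theorem Mon.eq_one_of_toGp_eq_one (h : p ≤ r) {m : Mon p q r s} (hm : Mon.toGp q s h m = 1) :
    m = 1 := by
  obtain ⟨K, _, f, hf⟩ := (Mon.isOType (q := q) (s := s) (.inl h)).exists_group_hom
  obtain ⟨φ, hx, hy⟩ : ∃ φ : Gp p q r s →* K, φ (Gp.x p q r s) = f (Mon.a p q r s) ∧
      φ (Gp.y p q r s) = f (Mon.c p q r s * Mon.a p q r s ^ p) := by
    have hrel : ∀ t ∈ ({FreeGroup.of Gen₂.x ^ (p + 1) * ((FreeGroup.of Gen₂.y *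
        (FreeGroup.of Gen₂.x ^ (r - p) * FreeGroup.of Gen₂.y) ^ s) ^ (q + 1))⁻¹} :
        Set (FreeGroup Gen₂)), FreeGroup.lift (fun
          | .x => f (Mon.a p q r s)
          | .y => f (Mon.c p q r s * Mon.a p q r s ^ p)) t = 1 := by
      rintro _ rfl
      simp only [map_mul, map_pow, map_inv, FreeGroup.lift_apply_of]
      rw [mul_inv_eq_one, mul_pow_mul_pow_sub _ _ h]
      simp only [← map_mul, ← map_pow]
      rw [← Mon.b_eq, Mon.pow_b_a]
    exact ⟨PresentedGroup.toGroup hrel, PresentedGroup.toGroup.of hrel,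
      PresentedGroup.toGroup.of hrel⟩
  have hc : φ (Gp.c p q r s) = f (Mon.c p q r s) := by
    rw [Gp.c, map_mul, map_inv, map_pow, hx, hy, map_mul, map_pow, mul_inv_cancel_right]
  have hb : φ (Gp.b p q r s) = f (Mon.b p q r s) := by
    rw [Gp.b, Mon.b_eq, map_mul, map_pow, map_mul, map_pow, hx, hc]
    simp only [map_mul, map_pow]
  have hcomp : ∀ m, φ (Mon.toGp q s h m) = f m := by
    intro m
    induction m using Mon.induction_gen with
    | one => rw [map_one, map_one, map_one]
    | ha g ih => rw [map_mul, map_mul, map_mul, ih, Mon.toGp_a, hx]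
    | hb g ih => rw [map_mul, map_mul, map_mul, ih, Mon.toGp_b, hb]
    | hc g ih => rw [map_mul, map_mul, map_mul, ih, Mon.toGp_c, hc]
  exact hf m (by rw [← hcomp, hm, map_one])

/-- The subsemigroup of the group generated by `x` and `y x ^ (-p)`. -/
def Gp.cone (p q r s : ℕ) : Subsemigroup (Gp p q r s) :=
  Subsemigroup.closure {Gp.x p q r s, Gp.y p q r s * (Gp.x p q r s ^ p)⁻¹}

theorem Gp.x_mem_cone : Gp.x p q r s ∈ Gp.cone p q r s :=
  Subsemigroup.subset_closure (by simp)

theorem Gp.c_mem_cone : Gp.c p q r s ∈ Gp.cone p q r s :=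
  Subsemigroup.subset_closure (by simp [Gp.c])

theorem mul_pow_mem_of_mem {G : Type*} [Monoid G] {P : Subsemigroup G} {g h : G} (hg : g ∈ P)
    (hh : h ∈ P) (n : ℕ) : g * h ^ n ∈ P := by
  induction n with
  | zero => simpa using hg
  | succ n ih => rw [pow_succ, ← mul_assoc]; exact P.mul_mem ih hh

theorem Gp.b_mem_cone : Gp.b p q r s ∈ Gp.cone p q r s := by
  refine mul_pow_mem_of_mem Gp.c_mem_cone ?_ s
  -- The cone does not contain x^0 = 1, so r = 0 is separate.
  cases r with
  | zero => simpa using Gp.c_mem_cone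
  | succ r =>
    rw [pow_succ' (Gp.x p q (r + 1) s)]
    exact (Gp.cone p q (r + 1) s).mul_mem (mul_pow_mem_of_mem Gp.x_mem_cone Gp.x_mem_cone r)
      Gp.c_mem_cone

theorem Mon.toGp_mem_cone (h : p ≤ r) (m : Mon p q r s) :
    Mon.toGp q s h m = 1 ∨ Mon.toGp q s h m ∈ Gp.cone p q r s := by
  have key : ∀ {g k : Gp p q r s}, g ∈ Gp.cone p q r s → k = 1 ∨ k ∈ Gp.cone p q r s →
      g * k = 1 ∨ g * k ∈ Gp.cone p q r s := by
    rintro g k hg (rfl | hk)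
    · exact .inr (by rwa [mul_one])
    · exact .inr ((Gp.cone p q r s).mul_mem hg hk)
  induction m using Mon.induction_gen with
  | one => exact .inl (map_one _)
  | ha m ih => rw [map_mul, toGp_a]; exact key Gp.x_mem_cone ih
  | hb m ih => rw [map_mul, toGp_b]; exact key Gp.b_mem_cone ih
  | hc m ih => rw [map_mul, toGp_c]; exact key Gp.c_mem_cone ih

theorem Mon.c_ne_one : Mon.c p q r s ≠ 1 := by
  intro h
  obtain ⟨n, hn⟩ := Mon.mk_eq_mk.1
    (h.trans (map_one (PresentedMonoid.mk (MonRel p q r s))).symm)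
  exact List.cons_ne_nil _ _ (hn.eq_nil rfl)

theorem Mon.a_ne_one : Mon.a p q r s ≠ 1 := by
  intro h
  obtain ⟨n, hn⟩ := Mon.mk_eq_mk.1
    (h.trans (map_one (PresentedMonoid.mk (MonRel p q r s))).symm)
  exact List.cons_ne_nil _ _ (hn.eq_nil rfl)

theorem Gp.exists_toGp_eq (h : p ≤ r) {g : Gp p q r s} (hg : g ∈ Gp.cone p q r s) :
    ∃ m, m ≠ 1 ∧ Mon.toGp q s h m = g := by
  induction hg using Subsemigroup.closure_induction with
  | mem g hg =>
    rcases hg with rfl | rfl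
    · exact ⟨_, Mon.a_ne_one, Mon.toGp_a h⟩
    · exact ⟨_, Mon.c_ne_one, Mon.toGp_c h⟩
  | mul g k _ _ ihg ihk =>
    obtain ⟨m, hm, rfl⟩ := ihg
    obtain ⟨n, -, rfl⟩ := ihk
    exact ⟨m * n, fun e => hm (Mon.eq_one_of_mul_eq_one _ _ e), map_mul _ _ _⟩

theorem Gp.one_notMem_cone (h : p ≤ r) : (1 : Gp p q r s) ∉ Gp.cone p q r s := by
  intro h1
  obtain ⟨m, hm, hm1⟩ := Gp.exists_toGp_eq h h1
  exact hm (Mon.eq_one_of_toGp_eq_one h hm1)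

theorem Gp.exists_toGp_or_inv (h : p ≤ r) (g : Gp p q r s) :
    ∃ m, Mon.toGp q s h m = g ∨ Mon.toGp q s h m = g⁻¹ := by
  have hO := Mon.isOType (q := q) (s := s) (.inl h)
  -- The image together with its inverses is stable under left multiplication by n and n⁻¹:
  -- left-divisibility simplifies n⁻¹ m, right-divisibility n m⁻¹.
  have hmul : ∀ (n : Mon p q r s) {g : Gp p q r s},
      (∃ m, Mon.toGp q s h m = g ∨ Mon.toGp q s h m = g⁻¹) →
      (∃ m, Mon.toGp q s h m = Mon.toGp q s h n * g ∨
        Mon.toGp q s h m = (Mon.toGp q s h n * g)⁻¹) ∧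
      (∃ m, Mon.toGp q s h m = (Mon.toGp q s h n)⁻¹ * g ∨
        Mon.toGp q s h m = ((Mon.toGp q s h n)⁻¹ * g)⁻¹) := by
    rintro n g ⟨m, hm | hm⟩
    · refine ⟨⟨n * m, .inl (by rw [map_mul, hm])⟩, ?_⟩
      rcases hO.1.total n m with ⟨k, rfl⟩ | ⟨k, rfl⟩
      · exact ⟨k, .inl (by rw [← hm, map_mul, inv_mul_cancel_left])⟩
      · exact ⟨k, .inr (by rw [← hm, map_mul]; group)⟩
    · obtain rfl : g = (Mon.toGp q s h m)⁻¹ := by rw [hm, inv_inv]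
      refine ⟨?_, ⟨m * n, .inr (by rw [map_mul]; group)⟩⟩
      rcases hO.2.total n m with ⟨k, rfl⟩ | ⟨k, rfl⟩
      · exact ⟨k, .inr (by rw [map_mul]; group)⟩
      · exact ⟨k, .inl (by rw [map_mul]; group)⟩
  have hy : Gp.y p q r s = Mon.toGp q s h (Mon.c p q r s * Mon.a p q r s ^ p) := by
    rw [map_mul, map_pow, Mon.toGp_a, Mon.toGp_c, Gp.c, inv_mul_cancel_right]
  have hgen : ∀ i : Gen₂, ∃ n, (PresentedGroup.of i : Gp p q r s) = Mon.toGp q s h n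
    | .x => ⟨_, (Mon.toGp_a h).symm⟩
    | .y => ⟨_, hy⟩
  have hmem : g ∈ Subgroup.closure (Set.range (PresentedGroup.of : Gen₂ → Gp p q r s)) := by
    rw [PresentedGroup.closure_range_of]
    trivial
  induction hmem using Subgroup.closure_induction_left with
  | one => exact ⟨1, .inl (map_one _)⟩
  | mul_left x hx y _ ih =>
    obtain ⟨i, rfl⟩ := hx
    obtain ⟨n, hn⟩ := hgen i
    rw [hn]
    exact (hmul n ih).1
  | inv_mul_cancel x hx y _ ih =>
    obtain ⟨i, rfl⟩ := hx
    obtain ⟨n, hn⟩ := hgen i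
    rw [hn]
    exact (hmul n ih).2

theorem Gp.mem_cone_or (h : p ≤ r) (g : Gp p q r s) :
    g ∈ Gp.cone p q r s ∨ g = 1 ∨ g⁻¹ ∈ Gp.cone p q r s := by
  obtain ⟨m, hm | hm⟩ := Gp.exists_toGp_or_inv h g
  · rcases Mon.toGp_mem_cone h m with H | H
    · exact .inr (.inl (hm.symm.trans H))
    · exact .inl (hm ▸ H)
  · rcases Mon.toGp_mem_cone h m with H | H
    · exact .inr (.inl (inv_eq_one.1 (hm.symm.trans H)))
    · exact .inr (.inr (hm ▸ H))

end OTypeMonoid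

theorem corollary8p8 (p q r s : ℕ) :
    (p ≤ r →
      OTypeMonoid.LeftOrderable (OTypeMonoid.Gp p q r s) ∧
      ∃ L : OTypeMonoid.LeftOrdering (OTypeMonoid.Gp p q r s),
        L.positiveCone =
          (Subsemigroup.closure
            {OTypeMonoid.Gp.x p q r s,
              OTypeMonoid.Gp.y p q r s * (OTypeMonoid.Gp.x p q r s ^ p)⁻¹} :
            Set (OTypeMonoid.Gp p q r s)) ∧
        L.Isolated) ∧
    (p ≤ r ∨ q = 0 →
      (OTypeMonoid.Dominates (OTypeMonoid.Mon.a p q r s) (OTypeMonoid.Mon.a p q r s) ∧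
        OTypeMonoid.Dominates (OTypeMonoid.Mon.a p q r s) (OTypeMonoid.Mon.b p q r s) ∧
        OTypeMonoid.Dominates (OTypeMonoid.Mon.a p q r s) (OTypeMonoid.Mon.c p q r s)) ∧
      OTypeMonoid.IsOType (OTypeMonoid.Mon p q r s)) ∧
    (r < p → 1 ≤ q → 1 ≤ s → ¬ OTypeMonoid.IsOType (OTypeMonoid.Mon p q r s)) := by
  refine ⟨fun h => ?_, fun h => ⟨OTypeMonoid.Mon.dominates_gen h, OTypeMonoid.Mon.isOType h⟩,
    OTypeMonoid.Mon.not_isOType⟩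
  have hcone := OTypeMonoid.LeftOrdering.positiveCone_ofCone _
    (OTypeMonoid.Gp.one_notMem_cone (q := q) (s := s) h) (OTypeMonoid.Gp.mem_cone_or h)
  exact ⟨⟨.ofCone _ (OTypeMonoid.Gp.one_notMem_cone h) (OTypeMonoid.Gp.mem_cone_or h)⟩, _, hcone,
    OTypeMonoid.LeftOrdering.isolated_of_closure_pair _ _ _ hcone⟩
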